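/- Let $\mathbb K$ be an algebraically closed field of characteristic $0$ (for instance $\mathbb C$), let $n\ge 0$, and let $V=\mathbb K^{2n}$. Identify $\Lambda^2(V)$ with the space of skew-symmetric $2n\times 2n$ matrices and let $\rho:\mathrm{gl}(2n)\to \mathrm{gl}(\Lambda^2(V))$, $\rho(X)Q = XQ+QX^{T}$, be the differential of the congruence action $Q\mapsto PQP^{T}$ of $\mathrm{GL}(2n)$. For $Q\in\Lambda^2(V)$ let $R_Q:\mathrm{gl}(2n)\to\Lambda^2(V)$, $R_Q(X)=\rho(X)Q$. By the Jordan--Kronecker theorem, every pencil $A+\lambda B$ of linear maps between finite-dimensional spaces has, in suitable bases, a block-diagonal form, unique up to permutation of blocks, with blocks of the following types: Jordan blocks $J_k(\mu)+\lambda I_k$ with eigenvalue $\mu\in\mathbb K$, Jordan blocks $I_k+\lambda J_k(0)$ with eigenvalue $\infty$ (where $J_k(\mu)$ is the upper triangular $k\times k$ Jordan matrix, $k \geq 1$), horizontal Kronecker blocks of size $(h-1)\times h$, $h\ge 1$, with $\lambda$ on the main diagonal, $1$ directly to the right of each $\lambda$, and $0$ elsewhere, and vertical Kronecker blocks of size $v\times(v-1)$,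 $v\ge1$, which are the transposes of the horizontal ones (a zero $0\times 1$ or $1\times 0$ block being allowed for $h=1$, $v=1$). The widths $h$ are called the horizontal indices and the heights $v$ the vertical indices. The algebraic type of the pencil consists of the horizontal indices, the vertical indices, the number of distinct eigenvalues of Jordan blocks, and, for each distinct eigenvalue, the sizes of the Jordan blocks with that eigenvalue. The Jordan--Kronecker (JK) invariants of $\rho$ are the algebraic type of $R_Q+\lambda R_B$ for a generic pair $(Q,B)\in\Lambda^2(V)\times\Lambda^2(V)$, that is, for all pairs in some non-empty Zariski open subset. **Theorem.** The JK invariants of $\rho$ are * $n(2n+1)$ horizontal indices $$\underbrace{1,\dots,1}_{3n},\qquad \underbrace{2,\dots,2}_{2n(n-1)};$$ * $n$ Jordan $1\times 1$ blocks with (pairwise) distinct eigenvalues; and there are no vertical indices. -/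

import Mathlib

attribute [local instance] LieRing.ofAssociativeRing

namespace JK

/-- The blocks of the Jordan--Kronecker normal form of a pair of linear maps.
`jordan μ k` and `jordanInf k` are the Jordan blocks of size `(k+1) × (k+1)` with eigenvalue `μ`
and `∞`; `horizontal k` is the horizontal Kronecker block of size `k × (k+1)`; `vertical k` is the
vertical Kronecker block of size `(k+1) × k`. For `k = 0` the Kronecker blocks are the `0 × 1` and
`1 × 0` blocks, of which the zero block of the normal form consists. -/
inductive Block (K : Type*) where
  | jordan (μ : K) (k : ℕ) : Block K
  | jordanInf (k : ℕ) : Block K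
  | horizontal (k : ℕ) : Block K
  | vertical (k : ℕ) : Block K

namespace Block

variable {K : Type*}

/-- The number of rows of a block. -/
def rows : Block K → ℕ
  | jordan _ k => k + 1
  | jordanInf k => k + 1
  | horizontal k => k
  | vertical k => k + 1

/-- The number of columns of a block. -/
def cols : Block K → ℕ
  | jordan _ k => k + 1
  | jordanInf k => k + 1
  | horizontal k => k + 1
  | vertical k => k

/-- The entry in row `i` and column `j` (counted from `0`) of the matrix `A` of the block
`A + λ B`. -/
def entryA [Field K] : Block K → ℕ → ℕ → K
  | jordan μ _, i, j => if i = j then μ else if i + 1 = j then 1 else 0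
  | jordanInf _, i, j => if i = j then 1 else 0
  | horizontal _, i, j => if i + 1 = j then 1 else 0
  | vertical _, i, j => if i = j + 1 then 1 else 0

/-- The entry in row `i` and column `j` (counted from `0`) of the matrix `B` of the block
`A + λ B`. -/
def entryB [Field K] : Block K → ℕ → ℕ → K
  | jordan _ _, i, j => if i = j then 1 else 0
  | jordanInf _, i, j => if i + 1 = j then 1 else 0
  | horizontal _, i, j => if i = j then 1 else 0
  | vertical _, i, j => if i = j then 1 else 0

/-- The matrix `A` of the block `A + λ B`. -/
def matA [Field K] (b : Block K) : Matrix (Fin b.rows) (Fin b.cols) K :=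
  Matrix.of fun i j => b.entryA i j

/-- The matrix `B` of the block `A + λ B`. -/
def matB [Field K] (b : Block K) : Matrix (Fin b.rows) (Fin b.cols) K :=
  Matrix.of fun i j => b.entryB i j

/-- The width of a horizontal Kronecker block; `none` for the other blocks. -/
def horizontalIndex : Block K → Option ℕ
  | horizontal k => some (k + 1)
  | _ => none

/-- The height of a vertical Kronecker block; `none` for the other blocks. -/
def verticalIndex : Block K → Option ℕ
  | vertical k => some (k + 1)
  | _ => none

/-- The eigenvalue (in `K ∪ {∞}`) and the size of a Jordan block; `none` for the other blocks. -/
def jordanData : Block K → Option (OnePoint K × ℕ)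
  | jordan μ k => some ((μ : OnePoint K), k + 1)
  | jordanInf k => some (OnePoint.infty, k + 1)
  | _ => none

end Block

/-- The discrete invariants of a pencil: the horizontal indices, the vertical indices, and, for
every distinct eigenvalue (the values themselves being forgotten), the sizes of the Jordan blocks
with that eigenvalue. So `jordan` has one member for each distinct eigenvalue. -/
structure AlgType where
  horizontal : Multiset ℕ
  vertical : Multiset ℕ
  jordan : Multiset (Multiset ℕ)

open Classical in
/-- For a multiset of pairs (eigenvalue, size): the multiset, indexed by the distinct eigenvalues,
of the multisets of sizes that occur with that eigenvalue. -/
noncomputable def sizesByEigenvalue {E : Type*} (J : Multiset (E × ℕ)) : Multiset (Multiset ℕ) :=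
  (J.map Prod.fst).dedup.map fun μ => (J.filter fun p => p.1 = μ).map Prod.snd

/-- The discrete invariants of a collection of blocks. -/
noncomputable def algTypeOfBlocks {K : Type*} (s : Multiset (Block K)) : AlgType where
  horizontal := s.filterMap Block.horizontalIndex
  vertical := s.filterMap Block.verticalIndex
  jordan := sizesByEigenvalue (s.filterMap Block.jordanData)

/-- In suitable bases of `U` and `V` the pencil `A + λ B` is block diagonal with the
Jordan--Kronecker blocks `b i`. -/
def HasNormalForm {K U V : Type*} [Field K] [AddCommGroup U] [Module K U]
    [AddCommGroup V] [Module K V] (A B : U →ₗ[K] V)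
    {ι : Type} [Fintype ι] [DecidableEq ι] (b : ι → Block K) : Prop :=
  ∃ (e : Module.Basis (Σ i, Fin (b i).cols) K U) (f : Module.Basis (Σ i, Fin (b i).rows) K V),
    LinearMap.toMatrix e f A = Matrix.blockDiagonal' (fun i => (b i).matA) ∧
    LinearMap.toMatrix e f B = Matrix.blockDiagonal' (fun i => (b i).matB)

/-- `T` is the algebraic type of the pencil `A + λ B`: the pencil has a Jordan--Kronecker normal
form whose blocks have the discrete invariants `T`. -/
def HasAlgType {K U V : Type*} [Field K] [AddCommGroup U] [Module K U]
    [AddCommGroup V] [Module K V] (A B : U →ₗ[K] V) (T : AlgType) : Prop :=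
  ∃ (ι : Type) (_ : Fintype ι) (_ : DecidableEq ι) (b : ι → Block K),
    HasNormalForm A B b ∧ algTypeOfBlocks (Finset.univ.val.map b) = T

/-- `P` holds for a generic `w ∈ W`: it holds on a non-empty Zariski open subset of `W`, namely
wherever some polynomial function on `W` that is not identically zero does not vanish. Polynomial
functions are written as polynomials in the linear functionals on `W`. -/
def Generically {K W : Type*} [Field K] [AddCommGroup W] [Module K W] (P : W → Prop) : Prop :=
  ∃ p : MvPolynomial (Module.Dual K W) K,
    (∃ w : W, MvPolynomial.eval (fun φ : Module.Dual K W => φ w) p ≠ 0) ∧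
    ∀ w : W, MvPolynomial.eval (fun φ : Module.Dual K W => φ w) p ≠ 0 → P w

/-- The operator `R_x : 𝔤 → V`, `R_x ξ = ρ(ξ) x`. -/
def orbitMap {K L V : Type*} [Field K] [LieRing L] [LieAlgebra K L] [AddCommGroup V] [Module K V]
    (ρ : L →ₗ⁅K⁆ Module.End K V) (x : V) : L →ₗ[K] V where
  toFun ξ := ρ ξ x
  map_add' ξ η := by simp
  map_smul' c ξ := by simp

/-- `T` is the Jordan--Kronecker invariant of the representation `ρ`: the algebraic type of the
pencil `R_a + λ R_b` for a generic pair `(a, b) ∈ V × V`. -/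
def IsJKInvariant {K L V : Type*} [Field K] [LieRing L] [LieAlgebra K L] [AddCommGroup V]
    [Module K V] (ρ : L →ₗ⁅K⁆ Module.End K V) (T : AlgType) : Prop :=
  Generically (K := K) (W := V × V) fun w => HasAlgType (orbitMap ρ w.1) (orbitMap ρ w.2) T

/-- The space `Λ²(V)` of skew-symmetric forms, `V = K^m`, as skew-symmetric matrices. -/
def skewForms (K : Type*) [Field K] (m : ℕ) : Submodule K (Matrix (Fin m) (Fin m) K) where
  carrier := {Q | Q.transpose = -Q}
  zero_mem' := by simp
  add_mem' {P Q} hP hQ := by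
    simp only [Set.mem_ofPred_eq] at hP hQ ⊢
    rw [Matrix.transpose_add, hP, hQ, neg_add]
  smul_mem' c Q hQ := by
    simp only [Set.mem_ofPred_eq] at hQ ⊢
    rw [Matrix.transpose_smul, hQ, smul_neg]

/-- The differential `ρ(X) Q = X Q + Q Xᵀ` of the congruence action `Q ↦ P Q Pᵀ` of `GL(m)`,
as a representation of the Lie algebra `gl(m)` on skew-symmetric forms. -/
def congruenceRep (K : Type*) [Field K] (m : ℕ) :
    Matrix (Fin m) (Fin m) K →ₗ⁅K⁆ Module.End K (skewForms K m) where
  toFun X :=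
    { toFun := fun Q => ⟨X * Q.1 + Q.1 * X.transpose, by
        have hQ : Q.1.transpose = -Q.1 := Q.2
        change (X * Q.1 + Q.1 * X.transpose).transpose = -(X * Q.1 + Q.1 * X.transpose)
        rw [Matrix.transpose_add, Matrix.transpose_mul, Matrix.transpose_mul,
          Matrix.transpose_transpose, hQ]
        simp [add_comm]⟩
      map_add' := fun P Q => by
        ext1
        simp only [Submodule.coe_add, mul_add, add_mul]
        abel
      map_smul' := fun c Q => by
        ext1
        simp }
  map_add' X Y := by
    ext1 Q
    ext1
    simp only [LinearMap.add_apply, LinearMap.coe_mk, AddHom.coe_mk, Submodule.coe_add,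
      Matrix.transpose_add, mul_add, add_mul]
    abel
  map_smul' c X := by
    ext1 Q
    ext1
    simp
  map_lie' {X Y} := by
    ext1 Q
    ext1
    simp only [Ring.lie_def, LinearMap.sub_apply, Module.End.mul_apply, LinearMap.coe_mk,
      AddHom.coe_mk, Submodule.coe_sub, Matrix.transpose_sub, Matrix.transpose_mul, mul_add,
      add_mul, mul_sub, sub_mul, mul_assoc]
    abel

end JK

/-! ### Counting distinct eigenvalues by power sums -/

namespace JK

/-! For invertible `B` the matrix `M = adj(B) Q` is self-adjoint for the symplectic form `B`.
Generically it has `n` distinct eigenvalues, each double, so a discriminant cannot detect them; the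
Hankel determinant of the traces `tr (M ^ k)` can (`exists_injective_isRoot_charpoly`). Generalized
eigenspaces are `B`-orthogonal, and a hyperbolic pair taken from each brings `(Q, B)` by congruence
to antidiagonal form with blocks `diag(w)` and `1` (`exists_congruence_normal_form`). In that basis,
with `Y = S X S⁻¹`, each entry of `R_B X` is up to signs a sum `x + y` of two entries of `Y`, and
that of `R_Q X` is `w_j x + w_i y`. For `i ≠ j` these two values are independent and form a `1 × 2`
Kronecker block. For `i = j` they are proportional with ratio `w_i` (a Jordan block) or both zero;
`3n` kernel directions remain (`hasAlgType_of_congruence`). -/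

open Polynomial in
/-- The product of `X - x` over the distinct eigenvalues of `M` is nilpotent at `M`. -/
theorem isNilpotent_aeval_prod_roots {K m : Type*} [Field K] [IsAlgClosed K] [DecidableEq K]
    [Fintype m] [DecidableEq m] (M : Matrix m m K) :
    IsNilpotent (aeval M (∏ x ∈ M.charpoly.roots.toFinset, (X - C x))) := by
  -- Each linear factor of the characteristic polynomial divides `r`, so one power of `r` per root,
  -- with multiplicity, suffices for Cayley–Hamilton.
  refine ⟨Multiset.card M.charpoly.roots, ?_⟩
  set r : K[X] := ∏ x ∈ M.charpoly.roots.toFinset, (X - C x) with hr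
  have hdvd : M.charpoly ∣ r ^ Multiset.card M.charpoly.roots := by
    conv_lhs => rw [(IsAlgClosed.splits M.charpoly).eq_prod_roots_of_monic M.charpoly_monic]
    have := Multiset.prod_dvd_prod_of_dvd (S := M.charpoly.roots) (fun x => X - C x) (fun _ => r)
      (fun x hx => Finset.dvd_prod_of_mem (fun x => X - C x) (Multiset.mem_toFinset.2 hx))
    simpa using this
  obtain ⟨q, hq⟩ := hdvd
  rw [← map_pow, hq, map_mul, Matrix.aeval_self_charpoly, zero_mul]

/-- If the Hankel matrix of the power sums `tr (M ^ k)` of order `n` is nonsingular, then `M` has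
at least `n` distinct eigenvalues. -/
theorem exists_injective_isRoot_charpoly {K m : Type*} [Field K] [IsAlgClosed K]
    [Fintype m] [DecidableEq m] (M : Matrix m m K) (n : ℕ)
    (h : (Matrix.of fun a b : Fin n => (M ^ (a + b : ℕ)).trace).det ≠ 0) :
    ∃ μ : Fin n → K, Function.Injective μ ∧ ∀ i, M.charpoly.IsRoot (μ i) := by
  classical
  set s := M.charpoly.roots.toFinset with hs
  by_cases hn : n ≤ s.card
  · obtain ⟨g⟩ : Nonempty (Fin n ↪ s) :=
      Function.Embedding.nonempty_of_card_le (by simpa using hn)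
    refine ⟨fun i => g i, fun i j hij => g.injective (Subtype.ext hij), fun i => ?_⟩
    exact Polynomial.isRoot_of_mem_roots (Multiset.mem_toFinset.1 (g i).2)
  · exfalso
    push Not at hn
    set r : Polynomial K := ∏ x ∈ s, (Polynomial.X - Polynomial.C x) with hr
    have hmonic : r.Monic := Polynomial.monic_prod_of_monic _ _ fun x _ => Polynomial.monic_X_sub_C x
    have hdeg : r.natDegree = s.card := by
      rw [hr, Polynomial.natDegree_prod_of_monic _ _ fun x _ => Polynomial.monic_X_sub_C x]
      simp
    -- With fewer than `n` eigenvalues, `r` has degree below `n`. Its coefficient vector is nonzero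
    -- because `r` is monic, and the Hankel matrix kills it because every `M ^ a * r(M)` is
    -- nilpotent, hence of trace zero.
    refine h (Matrix.exists_mulVec_eq_zero_iff.1 ⟨fun a => r.coeff a, fun h0 => ?_, ?_⟩)
    · have := congrFun h0 ⟨s.card, hn⟩
      simp only [Pi.zero_apply, ← hdeg, hmonic.coeff_natDegree] at this
      exact one_ne_zero this
    · funext a
      have hnil : IsNilpotent (M ^ (a : ℕ) * Polynomial.aeval M r) :=
        Commute.isNilpotent_mul_left
          (by simpa using (Polynomial.commute_X_pow r a).map (Polynomial.aeval (R := K) M))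
          (isNilpotent_aeval_prod_roots M)
      have htr := (Matrix.isNilpotent_trace_of_isNilpotent hnil).eq_zero
      rw [Polynomial.aeval_eq_sum_range' (hdeg ▸ hn : r.natDegree < n), Finset.mul_sum,
        Matrix.trace_sum, Finset.sum_range] at htr
      simpa [Matrix.mulVec, dotProduct, pow_add, mul_comm] using htr

end JK
-- Self-adjoint operators and pairs of skew-symmetric matrices
namespace JK

section SelfAdjoint

variable {K V : Type*} [Field K] [AddCommGroup V] [Module K V] {β : LinearMap.BilinForm K V}
  {f : Module.End K V}

theorem apply_aeval_left (hf : ∀ x y, β (f x) y = β x (f y)) (p : Polynomial K) (x y : V) :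
    β (Polynomial.aeval f p x) y = β x (Polynomial.aeval f p y) := by
  induction p using Polynomial.induction_on' generalizing x y with
  | add p q hp hq => simp [hp, hq]
  | monomial k c =>
    simp only [Polynomial.aeval_monomial, Module.algebraMap_end_eq_smul_id, Module.End.mul_apply,
      LinearMap.smul_apply, LinearMap.id_apply, map_smul]
    congr 1
    induction k generalizing x y with
    | zero => simp
    | succ k ih => rw [pow_succ, Module.End.mul_apply, ih, hf, ← Module.End.mul_apply,
        ← pow_succ', pow_succ]

/-- Generalized eigenspaces of a self-adjoint operator for distinct eigenvalues are orthogonal. -/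
theorem apply_eq_zero_of_mem_maxGenEigenspace (hf : ∀ x y, β (f x) y = β x (f y)) {μ ν : K}
    (h : μ ≠ ν) {x y : V} (hx : x ∈ f.maxGenEigenspace μ) (hy : y ∈ f.maxGenEigenspace ν) :
    β x y = 0 := by
  obtain ⟨k, hk⟩ := (Module.End.mem_maxGenEigenspace f μ x).1 hx
  obtain ⟨l, hl⟩ := (Module.End.mem_maxGenEigenspace f ν y).1 hy
  -- By Bézout `(f - ν) ^ l` can be inverted at `x`; moved across `β`, it annihilates `y`.
  obtain ⟨a, b, hab⟩ : IsCoprime ((Polynomial.X - Polynomial.C μ) ^ k)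
      ((Polynomial.X - Polynomial.C ν) ^ l) :=
    (Polynomial.isCoprime_X_sub_C_of_isUnit_sub (sub_ne_zero.2 h).isUnit).pow
  have aev (c : K) (j : ℕ) : Polynomial.aeval f ((Polynomial.X - Polynomial.C c) ^ j) =
      (f - c • 1) ^ j := by
    simp [Algebra.algebraMap_eq_smul_one]
  have hy' : Polynomial.aeval f ((Polynomial.X - Polynomial.C ν) ^ l) y = 0 := by rw [aev, hl]
  have hx' : Polynomial.aeval f ((Polynomial.X - Polynomial.C μ) ^ k) x = 0 := by rw [aev, hk]
  have h1 : x = Polynomial.aeval f ((Polynomial.X - Polynomial.C ν) ^ l)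
      (Polynomial.aeval f b x) := by
    conv_lhs =>
      rw [← Module.End.one_apply (R := K) x, ← map_one (Polynomial.aeval (R := K) f), ← hab]
    rw [map_add, LinearMap.add_apply, map_mul, Module.End.mul_apply, hx', map_zero, zero_add,
      mul_comm, map_mul, Module.End.mul_apply]
  rw [h1, apply_aeval_left hf, hy', map_zero]

/-- An operator that is self-adjoint for a symplectic form, with distinct eigenvalues `μ i`:
eigenvectors `v i` and dual generalized eigenvectors `w i`. -/
theorem exists_hyperbolic_pairs [IsAlgClosed K] [FiniteDimensional K V]
    (hf : ∀ x y, β (f x) y = β x (f y)) (halt : β.IsAlt)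
    (hβ : ∀ x, (∀ y, β x y = 0) → x = 0) {n : ℕ} (μ : Fin n → K) (hμ : Function.Injective μ)
    (hev : ∀ i, f.HasEigenvalue (μ i)) :
    ∃ v w : Fin n → V, (∀ i, f (v i) = μ i • v i) ∧
      (∀ i j, β (v i) (w j) = if i = j then 1 else 0) ∧
      (∀ i j, β (v i) (v j) = 0) ∧ (∀ i j, β (w i) (w j) = 0) ∧
      ∀ i j, i ≠ j → β (w i) (f (w j)) = 0 := by
  have key (i : Fin n) : ∃ v w : V, f v = μ i • v ∧ v ∈ f.maxGenEigenspace (μ i) ∧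
      w ∈ f.maxGenEigenspace (μ i) ∧ β v w = 1 := by
    obtain ⟨v, hv⟩ := (hev i).exists_hasEigenvector
    have hvG : v ∈ f.maxGenEigenspace (μ i) :=
      (Module.End.mem_maxGenEigenspace f (μ i) v).2 ⟨1, by simp [hv.apply_eq_smul]⟩
    -- `v` is orthogonal to all other generalized eigenspaces, and together they span `V`;
    -- nondegeneracy forces a partner in its own.
    have hw : ∃ w ∈ f.maxGenEigenspace (μ i), β v w ≠ 0 := by
      by_contra! hcon
      refine hv.2 (hβ v fun y => ?_)
      have hy : y ∈ ⨆ c, f.maxGenEigenspace c := by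
        rw [Module.End.iSup_maxGenEigenspace_eq_top]; trivial
      refine Submodule.iSup_induction (motive := fun y => β v y = 0) _ hy (fun c x hx => ?_)
        (map_zero _) fun x y hx hy => by rw [map_add, hx, hy, add_zero]
      rcases eq_or_ne (μ i) c with rfl | hc
      · exact hcon x hx
      · exact apply_eq_zero_of_mem_maxGenEigenspace hf hc hvG hx
    obtain ⟨w, hwG, hw⟩ := hw
    exact ⟨v, (β v w)⁻¹ • w, hv.apply_eq_smul, hvG, Submodule.smul_mem _ _ hwG, by simp [hw]⟩
  choose v w hv hvG hwG hvw using key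
  -- `w i` need not be an eigenvector; invariance of its generalized eigenspace is enough.
  have hfw (i : Fin n) : f (w i) ∈ f.maxGenEigenspace (μ i) :=
    Module.End.mapsTo_maxGenEigenspace_of_comm (Commute.refl f) (μ i) (hwG i)
  refine ⟨v, w, hv, fun i j => ?_, fun i j => ?_, fun i j => ?_, fun i j hij =>
    apply_eq_zero_of_mem_maxGenEigenspace hf (hμ.ne hij) (hwG i) (hfw j)⟩
  · split_ifs with hij
    · rw [← hij, hvw]
    · exact apply_eq_zero_of_mem_maxGenEigenspace hf (hμ.ne hij) (hvG i) (hwG j)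
  · rcases eq_or_ne i j with rfl | hij
    · exact halt _
    · exact apply_eq_zero_of_mem_maxGenEigenspace hf (hμ.ne hij) (hvG i) (hvG j)
  · rcases eq_or_ne i j with rfl | hij
    · exact halt _
    · exact apply_eq_zero_of_mem_maxGenEigenspace hf (hμ.ne hij) (hwG i) (hwG j)

end SelfAdjoint

open Matrix in
/-- Simultaneous normal form of a generic pair of skew-symmetric matrices. -/
theorem exists_congruence_normal_form {K m : Type*} [Field K] [IsAlgClosed K] [CharZero K]
    [Fintype m] [DecidableEq m] {n : ℕ} (Q B : Matrix m m K) (hQ : Qᵀ = -Q) (hB : Bᵀ = -B)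
    (hdet : B.det ≠ 0)
    (h : (Matrix.of fun a b : Fin n => ((B.adjugate * Q) ^ (a + b : ℕ)).trace).det ≠ 0) :
    ∃ (S : Matrix (Fin n ⊕ Fin n) m K) (w : Fin n → K), Function.Injective w ∧
      S * Q * Sᵀ = fromBlocks 0 (diagonal w) (-diagonal w) 0 ∧
      S * B * Sᵀ = fromBlocks 0 1 (-1) 0 := by
  set M := B.adjugate * Q with hM
  obtain ⟨μ, hμ, hroot⟩ := exists_injective_isRoot_charpoly M n h
  have hBM : B * M = B.det • Q := by
    rw [hM, ← Matrix.mul_assoc, mul_adjugate, smul_mul_assoc, Matrix.one_mul]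
  -- Self-adjointness of `M` for `B`: transpose `hBM` and cancel the signs from skewness.
  have hMB : Mᵀ * B = B * M := by
    have := congrArg transpose hBM
    rw [transpose_mul, hB, transpose_smul, hQ, Matrix.mul_neg, smul_neg, neg_inj] at this
    rw [this, hBM]
  clear_value M
  have skew (A : Matrix m m K) (hA : Aᵀ = -A) (x y : m → K) : x ⬝ᵥ A *ᵥ y = -(y ⬝ᵥ A *ᵥ x) := by
    rw [dotProduct_mulVec, ← mulVec_transpose, hA, neg_mulVec, neg_dotProduct, dotProduct_comm]
  let β : LinearMap.BilinForm K (m → K) := Matrix.toBilin' B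
  have hβ (x y : m → K) : β x y = x ⬝ᵥ B *ᵥ y := Matrix.toBilin'_apply' B x y
  obtain ⟨v, w, hv, hvw, hvv, hww, hwfw⟩ := exists_hyperbolic_pairs (β := β) (f := M.toLin')
    (fun x y => by
      rw [hβ, hβ, toLin'_apply, toLin'_apply, mulVec_mulVec y, ← hMB, ← mulVec_mulVec,
        dotProduct_mulVec x, vecMul_transpose])
    (fun x => by
      rw [hβ]
      exact self_eq_neg.1 (skew B hB x x))
    (fun x hx => Matrix.eq_zero_of_vecMul_eq_zero hdet (dotProduct_eq_zero _ fun y => by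
      rw [← dotProduct_mulVec, ← hβ, hx]))
    μ hμ (fun i => by
      rw [Module.End.hasEigenvalue_iff_isRoot_charpoly]
      simpa using hroot i)
  have hQβ (x y : m → K) : x ⬝ᵥ Q *ᵥ y = B.det⁻¹ * β x (M.toLin' y) := by
    rw [hβ, toLin'_apply, mulVec_mulVec, hBM, smul_mulVec, dotProduct_smul, smul_eq_mul,
      inv_mul_cancel_left₀ hdet]
  have ent (A : Matrix m m K) (i j : Fin n ⊕ Fin n) :
      (Matrix.of (Sum.elim v w) * A * (Matrix.of (Sum.elim v w))ᵀ) i j =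
        Sum.elim v w i ⬝ᵥ A *ᵥ Sum.elim v w j := by
    rw [dotProduct_mulVec]
    rfl
  have hwv (i j : Fin n) : w i ⬝ᵥ B *ᵥ v j = -if i = j then 1 else 0 := by
    rw [skew B hB, ← hβ, hvw]; simp [eq_comm]
  have hQwv (i j : Fin n) : w i ⬝ᵥ Q *ᵥ v j = -if i = j then B.det⁻¹ * μ i else 0 := by
    rw [hQβ, hv, map_smul, hβ, hwv]
    split_ifs with hij
    · subst hij; simp
    · simp
  -- The adjugate, used to stay polynomial, is `det B` times the inverse; the factor is removed
  -- here.
  refine ⟨Matrix.of (Sum.elim v w), fun i => B.det⁻¹ * μ i,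
    fun i j hij => hμ (mul_left_cancel₀ (inv_ne_zero hdet) hij), ?_, ?_⟩
  · ext (i | i) (j | j)
    · rw [ent]
      simp only [Sum.elim_inl, hQβ, hv, map_smul, hvv, smul_zero, mul_zero, fromBlocks_apply₁₁,
        Matrix.zero_apply]
    · rw [ent, Sum.elim_inl, Sum.elim_inr, skew Q hQ, hQwv]
      simp only [fromBlocks_apply₁₂, diagonal_apply, neg_neg]
      rcases eq_or_ne i j with rfl | hij
      · simp
      · simp [hij, hij.symm]
    · rw [ent, Sum.elim_inl, Sum.elim_inr, hQwv]
      simp only [fromBlocks_apply₂₁, Matrix.neg_apply, diagonal_apply]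
    · rw [ent, Sum.elim_inr, Sum.elim_inr]
      -- The diagonal case relies on skewness of `Q` alone, since `w i` may fail to be an
      -- eigenvector.
      rcases eq_or_ne i j with rfl | hij
      · simpa using self_eq_neg.1 (skew Q hQ (w i) (w i))
      · rw [hQβ, hwfw i j hij]; simp
  · ext (i | i) (j | j)
    · rw [ent, Sum.elim_inl, Sum.elim_inl, ← hβ, hvv]; simp
    · rw [ent, Sum.elim_inl, Sum.elim_inr, ← hβ, hvw]; simp [one_apply]
    · rw [ent, Sum.elim_inl, Sum.elim_inr, hwv]; simp [one_apply]
    · rw [ent, Sum.elim_inr, Sum.elim_inr, ← hβ, hww]; simp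

end JK
-- Normal forms from coordinates, and counting blocks
namespace JK

/-- A normal form is given by coordinates on both spaces in which the pencil acts by the blocks. -/
theorem hasNormalForm_of_coordinates {K U V : Type*} [Field K] [AddCommGroup U] [Module K U]
    [AddCommGroup V] [Module K V] {A B : U →ₗ[K] V} {ι : Type} [Fintype ι] [DecidableEq ι]
    {b : ι → Block K} (e : U ≃ₗ[K] ((Σ i, Fin (b i).cols) → K))
    (f : V ≃ₗ[K] ((Σ i, Fin (b i).rows) → K))
    (hA : ∀ u i r, f (A u) ⟨i, r⟩ = ∑ c : Fin (b i).cols, (b i).entryA r c * e u ⟨i, c⟩)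
    (hB : ∀ u i r, f (B u) ⟨i, r⟩ = ∑ c : Fin (b i).cols, (b i).entryB r c * e u ⟨i, c⟩) :
    HasNormalForm A B b := by
  refine ⟨Module.Basis.ofEquivFun e, Module.Basis.ofEquivFun f, ?_, ?_⟩
  all_goals
    ext ⟨i, r⟩ ⟨j, c⟩
    rw [LinearMap.toMatrix_apply, Matrix.blockDiagonal'_apply, Module.Basis.ofEquivFun_repr_apply,
      Module.Basis.coe_ofEquivFun]
    simp only [hA, hB, LinearEquiv.apply_symm_apply]
    split_ifs with hij
    · subst hij
      simp [Pi.single_apply, Block.matA, Block.matB]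
    · refine Finset.sum_eq_zero fun d _ => ?_
      rw [Pi.single_eq_of_ne, mul_zero]
      intro h
      exact hij (congrArg Sigma.fst h)

/-- Labels of the blocks of the normal form of the congruence representation. -/
abbrev BlockIndex (n : ℕ) : Type :=
  (Fin n × Fin 3) ⊕ ({p : Fin n × Fin n // p.1 ≠ p.2} × Bool) ⊕ Fin n

/-- The blocks of the normal form with Jordan eigenvalues `w i`. -/
def normalBlock {K : Type*} {n : ℕ} (w : Fin n → K) : BlockIndex n → Block K
  | .inl _ => .horizontal 0
  | .inr (.inl _) => .horizontal 1
  | .inr (.inr i) => .jordan (w i) 0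

theorem card_offDiag_subtype (n : ℕ) :
    Fintype.card {p : Fin n × Fin n // p.1 ≠ p.2} = n * (n - 1) := by
  have h : (Finset.univ.filter fun p : Fin n × Fin n => p.1 ≠ p.2) = Finset.univ.offDiag := by
    ext; simp
  rw [Fintype.card_subtype, h, Finset.offDiag_card]
  simp [Nat.mul_sub]

theorem sizesByEigenvalue_map_of_injective {E ι : Type*} [Fintype ι] {μ : ι → E}
    (hμ : Function.Injective μ) (k : ℕ) :
    sizesByEigenvalue ((Finset.univ : Finset ι).val.map fun i => (μ i, k)) =
      Multiset.replicate (Fintype.card ι) {k} := by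
  classical
  unfold sizesByEigenvalue
  have hfst : ((Finset.univ : Finset ι).val.map fun i => (μ i, k)).map Prod.fst =
      Finset.univ.val.map μ := by
    rw [Multiset.map_map]; rfl
  rw [hfst, Multiset.dedup_eq_self.2 (Finset.univ.nodup.map hμ), Multiset.map_map]
  rw [Multiset.map_congr rfl (g := fun _ => {k}), Multiset.map_const']
  · rfl
  · intro i _
    simp only [Function.comp_apply, Multiset.filter_map, Multiset.map_map]
    have : Multiset.filter (fun j => μ j = μ i) (Finset.univ : Finset ι).val = {i} := by
      refine (Multiset.Nodup.ext (Finset.univ.nodup.filter _) (Multiset.nodup_singleton i)).2 ?_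
      simp [hμ.eq_iff]
    simp [this]

theorem filterMap_eq_zero {α β : Type*} {g : α → Option β} {s : Multiset α}
    (h : ∀ a ∈ s, g a = none) : s.filterMap g = 0 := by
  refine Multiset.eq_zero_of_forall_notMem fun b hb => ?_
  obtain ⟨a, ha, hab⟩ := (Multiset.mem_filterMap g s).1 hb
  simp [h a ha] at hab

theorem filterMap_map_of_some {α β γ : Type*} {f : α → β} {g : β → Option γ} {g' : α → γ}
    (s : Multiset α) (h : ∀ a, g (f a) = some (g' a)) : (s.map f).filterMap g = s.map g' := by
  rw [Multiset.filterMap_map, ← Multiset.filterMap_eq_map g']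
  exact congrArg (fun u => Multiset.filterMap u s) (funext h)

theorem filterMap_replicate_of_some {α β : Type*} {g : α → Option β} {a : α} {b : β} (k : ℕ)
    (h : g a = some b) : (Multiset.replicate k a).filterMap g = Multiset.replicate k b := by
  have := filterMap_map_of_some (f := fun _ : Unit => a) (g' := fun _ => b)
    (Multiset.replicate k ()) fun _ => h
  simpa using this

theorem filterMap_replicate_of_none {α β : Type*} {g : α → Option β} {a : α} (k : ℕ)
    (h : g a = none) : (Multiset.replicate k a).filterMap g = 0 :=
  filterMap_eq_zero fun _ hb => Multiset.eq_of_mem_replicate hb ▸ h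

theorem algTypeOfBlocks_normalBlock {K : Type*} {n : ℕ} {w : Fin n → K}
    (hw : Function.Injective w) :
    algTypeOfBlocks (Finset.univ.val.map (normalBlock w)) =
      ⟨Multiset.replicate (3 * n) 1 + Multiset.replicate (2 * n * (n - 1)) 2, 0,
        Multiset.replicate n {1}⟩ := by
  have hsplit : (Finset.univ : Finset (BlockIndex n)).val.map (normalBlock w) =
      Multiset.replicate (3 * n) (.horizontal 0) +
        (Multiset.replicate (2 * n * (n - 1)) (.horizontal 1) +
          (Finset.univ : Finset (Fin n)).val.map fun i => .jordan (w i) 0) := by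
    rw [← Finset.univ_disjSum_univ, Finset.val_disjSum, Multiset.map_disjSum]
    congr 1
    · simp [normalBlock, mul_comm]
    · rw [← Finset.univ_disjSum_univ, Finset.val_disjSum, Multiset.map_disjSum]
      congr 1
      have hcard : Fintype.card ({p : Fin n × Fin n // p.1 ≠ p.2} × Bool) = 2 * n * (n - 1) := by
        rw [Fintype.card_prod, card_offDiag_subtype, Fintype.card_bool]; ring
      rw [← hcard]
      exact Multiset.map_const' _ _
  unfold algTypeOfBlocks
  simp only [hsplit, Multiset.filterMap_add, AlgType.mk.injEq]
  refine ⟨?_, ?_, ?_⟩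
  · rw [filterMap_replicate_of_some (g := Block.horizontalIndex) (b := 1) _ rfl,
      filterMap_replicate_of_some (g := Block.horizontalIndex) (b := 2) _ rfl,
      filterMap_eq_zero (s := Multiset.map _ _), add_zero]
    intro b hb
    obtain ⟨i, -, rfl⟩ := Multiset.mem_map.1 hb
    rfl
  · rw [filterMap_replicate_of_none (a := Block.horizontal 0) _ rfl,
      filterMap_replicate_of_none (a := Block.horizontal 1) _ rfl,
      filterMap_eq_zero (s := Multiset.map _ _), add_zero, add_zero]
    intro b hb
    obtain ⟨i, -, rfl⟩ := Multiset.mem_map.1 hb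
    rfl
  · rw [filterMap_replicate_of_none (a := Block.horizontal 0) _ rfl,
      filterMap_replicate_of_none (a := Block.horizontal 1) _ rfl,
      filterMap_map_of_some (g := Block.jordanData) (g' := fun i => ((w i : OnePoint K), 1)) _ fun i => rfl,
      zero_add, zero_add,
      sizesByEigenvalue_map_of_injective (μ := fun i => (w i : OnePoint K))
        (OnePoint.coe_injective.comp hw), Fintype.card_fin]

/-- The count `3n + 2 · 2n(n - 1) + n = 4n²` matches the dimension of `gl(2n)`, so injective column
coordinates are bijective. -/
theorem card_sigma_normalBlock_cols {K : Type*} {n : ℕ} (w : Fin n → K) :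
    Fintype.card (Σ i, Fin (normalBlock w i).cols) = 2 * n * (2 * n) := by
  have hoff : Fintype.card ({p : Fin n × Fin n // p.1 ≠ p.2} × Bool) = n * (n - 1) * 2 := by
    rw [Fintype.card_prod, card_offDiag_subtype, Fintype.card_bool]
  rw [Fintype.card_sigma]
  simp only [Fintype.card_fin]
  rw [Fintype.sum_sum_type, Fintype.sum_sum_type]
  simp only [Fintype.card_fin, normalBlock, Block.cols, Finset.sum_const, Finset.card_univ, hoff,
    Fintype.card_prod, smul_eq_mul]
  cases n with
  | zero => rfl
  | succ n => simp only [Nat.add_sub_cancel]; ring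

end JK
-- Coordinates adapted to the blocks
namespace JK

section Coordinates

open Matrix

variable {K : Type*} [Field K] {m n : ℕ}

/-- The entries of the skew-symmetric matrix `S W Sᵀ`, as linear functionals of `W`. -/
def congruenceEntry (S : Matrix (Fin n ⊕ Fin n) (Fin m) K)
    (p : (Fin n ⊕ Fin n) × (Fin n ⊕ Fin n)) : skewForms K m →ₗ[K] K where
  toFun W := (S * W.1 * Sᵀ) p.1 p.2
  map_add' W W' := by simp [Matrix.mul_add, Matrix.add_mul]
  map_smul' c W := by simp

/-- The entries of `S X T`, as linear functionals of `X`. -/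
def productEntry (S : Matrix (Fin n ⊕ Fin n) (Fin m) K) (T : Matrix (Fin m) (Fin n ⊕ Fin n) K)
    (p : (Fin n ⊕ Fin n) × (Fin n ⊕ Fin n)) : Matrix (Fin m) (Fin m) K →ₗ[K] K where
  toFun X := (S * X * T) p.1 p.2
  map_add' X X' := by simp [Matrix.mul_add, Matrix.add_mul]
  map_smul' c X := by simp

/-- Inserting `T * S = 1` next to `X` makes the action equivariant: congruence by `S` replaces `X`
by `S X T` and `Q` by `S Q Sᵀ`. -/
theorem congruenceEntry_orbitMap {S : Matrix (Fin n ⊕ Fin n) (Fin m) K}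
    {T : Matrix (Fin m) (Fin n ⊕ Fin n) K} (hTS : T * S = 1) (Q : skewForms K m)
    (X : Matrix (Fin m) (Fin m) K) (p : (Fin n ⊕ Fin n) × (Fin n ⊕ Fin n)) :
    congruenceEntry S p (orbitMap (congruenceRep K m) Q X) =
      (S * X * T * (S * Q.1 * Sᵀ) + S * Q.1 * Sᵀ * (S * X * T)ᵀ) p.1 p.2 := by
  have h1 : S * X * T * (S * Q.1 * Sᵀ) = S * (X * Q.1) * Sᵀ := by
    simp only [Matrix.mul_assoc]
    rw [← Matrix.mul_assoc T, hTS, Matrix.one_mul]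
  have h2 : S * Q.1 * Sᵀ * (S * X * T)ᵀ = S * (Q.1 * Xᵀ) * Sᵀ := by
    have hST : Sᵀ * Tᵀ = 1 := by rw [← transpose_mul, hTS, transpose_one]
    simp only [transpose_mul, Matrix.mul_assoc]
    rw [← Matrix.mul_assoc Sᵀ Tᵀ, hST, Matrix.one_mul]
  rw [h1, h2, ← Matrix.add_mul, ← Matrix.mul_add]
  rfl

/-- The positions of the entries of a skew-symmetric matrix that make up the blocks. -/
def rowPos : ({p : Fin n × Fin n // p.1 ≠ p.2} × Bool) ⊕ Fin n →
    (Fin n ⊕ Fin n) × (Fin n ⊕ Fin n)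
  | .inl (p, true) => (.inl p.1.1, .inr p.1.2)
  | .inl (p, false) => if p.1.1 < p.1.2 then (.inl p.1.1, .inl p.1.2) else (.inr p.1.1, .inr p.1.2)
  | .inr i => (.inl i, .inr i)

/-- The positions of the entries of a matrix that span the kernel coordinates. -/
def kernelPos (i : Fin n) : Fin 3 → (Fin n ⊕ Fin n) × (Fin n ⊕ Fin n)
  | 0 => (.inl i, .inl i)
  | 1 => (.inl i, .inr i)
  | 2 => (.inr i, .inl i)

/-- Coordinates on skew-symmetric matrices adapted to the normal form. -/
def rowCoord (S : Matrix (Fin n ⊕ Fin n) (Fin m) K) (w : Fin n → K) :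
    skewForms K m →ₗ[K] ((Σ i, Fin (normalBlock w i).rows) → K) :=
  LinearMap.pi fun
    | ⟨.inl _, _⟩ => 0
    | ⟨.inr q, _⟩ => congruenceEntry S (rowPos q)

/-- Coordinates on matrices adapted to the normal form. -/
def colCoord (S : Matrix (Fin n ⊕ Fin n) (Fin m) K) (T : Matrix (Fin m) (Fin n ⊕ Fin n) K)
    (Q B : skewForms K m) (w : Fin n → K) :
    Matrix (Fin m) (Fin m) K →ₗ[K] ((Σ i, Fin (normalBlock w i).cols) → K) :=
  LinearMap.pi fun
    | ⟨.inl (i, k), _⟩ => productEntry S T (kernelPos i k)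
    | ⟨.inr (.inl q), c⟩ => congruenceEntry S (rowPos (.inl q)) ∘ₗ
        orbitMap (congruenceRep K m) (if c.val = 0 then B else Q)
    | ⟨.inr (.inr i), _⟩ => congruenceEntry S (rowPos (.inr i)) ∘ₗ orbitMap (congruenceRep K m) B

section BlockEntries

variable (Y : Matrix (Fin n ⊕ Fin n) (Fin n ⊕ Fin n) K) (g : Fin n → K) (i j : Fin n)

theorem blockAction_inl_inr :
    (Y * fromBlocks 0 (diagonal g) (-diagonal g) 0 +
      fromBlocks 0 (diagonal g) (-diagonal g) 0 * Yᵀ) (.inl i) (.inr j) =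
    Y (.inl i) (.inl j) * g j + g i * Y (.inr j) (.inr i) := by
  simp [Matrix.mul_apply, diagonal_apply]

theorem blockAction_inl_inl :
    (Y * fromBlocks 0 (diagonal g) (-diagonal g) 0 +
      fromBlocks 0 (diagonal g) (-diagonal g) 0 * Yᵀ) (.inl i) (.inl j) =
    -(Y (.inl i) (.inr j) * g j) + g i * Y (.inl j) (.inr i) := by
  simp [Matrix.mul_apply, diagonal_apply]

theorem blockAction_inr_inr :
    (Y * fromBlocks 0 (diagonal g) (-diagonal g) 0 +
      fromBlocks 0 (diagonal g) (-diagonal g) 0 * Yᵀ) (.inr i) (.inr j) =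
    Y (.inr i) (.inl j) * g j - g i * Y (.inr j) (.inl i) := by
  simp [Matrix.mul_apply, diagonal_apply, sub_eq_add_neg]

end BlockEntries

theorem rowCoord_injective [CharZero K] {S : Matrix (Fin n ⊕ Fin n) (Fin m) K}
    {T : Matrix (Fin m) (Fin n ⊕ Fin n) K} (hTS : T * S = 1) (w : Fin n → K) :
    Function.Injective (rowCoord S w) := by
  rw [← LinearMap.ker_eq_bot, LinearMap.ker_eq_bot']
  intro W hW
  have hskew (a b : Fin n ⊕ Fin n) : (S * W.1 * Sᵀ) a b = -(S * W.1 * Sᵀ) b a := by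
    have hWt : W.1ᵀ = -W.1 := W.2
    have : (S * W.1 * Sᵀ)ᵀ = -(S * W.1 * Sᵀ) := by
      simp [transpose_mul, hWt, Matrix.mul_assoc]
    rw [← Matrix.neg_apply, ← this, transpose_apply]
  have hoff (q) : (S * W.1 * Sᵀ) (rowPos (.inl q)).1 (rowPos (.inl q)).2 = 0 :=
    congrFun hW ⟨.inr (.inl q), (0 : Fin 1)⟩
  have hdiag (i) : (S * W.1 * Sᵀ) (.inl i) (.inr i) = 0 :=
    congrFun hW ⟨.inr (.inr i), (0 : Fin 1)⟩
  have hlr (i j) : (S * W.1 * Sᵀ) (.inl i) (.inr j) = 0 := by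
    rcases eq_or_ne i j with rfl | hij
    · exact hdiag i
    · exact hoff (⟨(i, j), hij⟩, true)
  -- With flag `false`, pairs `i < j` index the upper left block and pairs `j < i` the lower right
  -- one; skewness supplies the other triangles.
  have hll (i j) (hij : i < j) : (S * W.1 * Sᵀ) (.inl i) (.inl j) = 0 := by
    simpa [rowPos, hij] using hoff (⟨(i, j), hij.ne⟩, false)
  have hrr (i j) (hij : j < i) : (S * W.1 * Sᵀ) (.inr i) (.inr j) = 0 := by
    simpa [rowPos, hij.not_gt] using hoff (⟨(i, j), hij.ne'⟩, false)
  have hzero : S * W.1 * Sᵀ = 0 := by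
    ext (i | i) (j | j)
    · rcases lt_trichotomy i j with hij | rfl | hij
      · exact hll i j hij
      · exact self_eq_neg.1 (hskew _ _)
      · rw [hskew, hll j i hij]; simp
    · exact hlr i j
    · rw [hskew, hlr j i]; simp
    · rcases lt_trichotomy i j with hij | rfl | hij
      · rw [hskew, hrr j i hij]; simp
      · exact self_eq_neg.1 (hskew _ _)
      · exact hrr i j hij
  have hST : Sᵀ * Tᵀ = 1 := by rw [← transpose_mul, hTS, transpose_one]
  ext1
  calc W.1 = T * S * W.1 * (Sᵀ * Tᵀ) := by rw [hTS, hST, Matrix.one_mul, Matrix.mul_one]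
    _ = T * (S * W.1 * Sᵀ) * Tᵀ := by simp only [Matrix.mul_assoc]
    _ = 0 := by rw [hzero, Matrix.mul_zero, Matrix.zero_mul]

/-- Off the diagonal, the `B`- and `Q`-values determine two entries of `Y` through a `2 × 2` system
with determinant `±(w i - w j)`; this is where distinctness enters. -/
theorem colCoord_injective {S : Matrix (Fin n ⊕ Fin n) (Fin m) K}
    {T : Matrix (Fin m) (Fin n ⊕ Fin n) K} (hTS : T * S = 1) {Q B : skewForms K m}
    {w : Fin n → K} (hw : Function.Injective w)
    (hQ : S * Q.1 * Sᵀ = fromBlocks 0 (diagonal w) (-diagonal w) 0)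
    (hB : S * B.1 * Sᵀ = fromBlocks 0 1 (-1) 0) :
    Function.Injective (colCoord S T Q B w) := by
  rw [← LinearMap.ker_eq_bot, LinearMap.ker_eq_bot']
  intro X hX
  set Y := S * X * T with hY
  have hker (i k) : Y (kernelPos i k).1 (kernelPos i k).2 = 0 :=
    congrFun hX ⟨.inl (i, k), (0 : Fin 1)⟩
  have hoffB (q) : congruenceEntry S (rowPos (.inl q)) (orbitMap (congruenceRep K m) B X) = 0 :=
    congrFun hX ⟨.inr (.inl q), (0 : Fin 2)⟩
  have hoffQ (q) : congruenceEntry S (rowPos (.inl q)) (orbitMap (congruenceRep K m) Q X) = 0 :=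
    congrFun hX ⟨.inr (.inl q), (1 : Fin 2)⟩
  have hdiagB (i) : congruenceEntry S (rowPos (.inr i)) (orbitMap (congruenceRep K m) B X) = 0 :=
    congrFun hX ⟨.inr (.inr i), (0 : Fin 1)⟩
  simp only [congruenceEntry_orbitMap hTS, hB, hQ, ← hY, ← diagonal_one] at hoffB hoffQ hdiagB
  have cancel {i j : Fin n} (hij : i ≠ j) {x y : K} (h1 : x + y = 0)
      (h2 : x * w j + w i * y = 0) : x = 0 ∧ y = 0 := by
    have hx : x * (w j - w i) = 0 := by linear_combination h2 - w i * h1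
    have hx0 : x = 0 := (mul_eq_zero.1 hx).resolve_right (sub_ne_zero.2 (hw.ne hij.symm))
    exact ⟨hx0, by simpa [hx0] using h1⟩
  have hlr (i j) (hij : i ≠ j) : Y (.inl i) (.inl j) = 0 ∧ Y (.inr j) (.inr i) = 0 := by
    have h1 := hoffB (⟨(i, j), hij⟩, true)
    have h2 := hoffQ (⟨(i, j), hij⟩, true)
    simp only [rowPos, blockAction_inl_inr, mul_one, one_mul] at h1 h2
    exact cancel hij h1 h2
  have hll (i j) (hij : i < j) : Y (.inl i) (.inr j) = 0 ∧ Y (.inl j) (.inr i) = 0 := by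
    have h1 := hoffB (⟨(i, j), hij.ne⟩, false)
    have h2 := hoffQ (⟨(i, j), hij.ne⟩, false)
    simp only [rowPos, hij, if_true, blockAction_inl_inl, mul_one, one_mul] at h1 h2
    rw [← neg_mul] at h2
    simpa using cancel hij.ne h1 h2
  have hrr (i j) (hij : j < i) : Y (.inr i) (.inl j) = 0 ∧ Y (.inr j) (.inl i) = 0 := by
    have h1 := hoffB (⟨(i, j), hij.ne'⟩, false)
    have h2 := hoffQ (⟨(i, j), hij.ne'⟩, false)
    simp only [rowPos, hij.not_gt, if_false, blockAction_inr_inr, mul_one, one_mul] at h1 h2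
    rw [sub_eq_add_neg] at h1 h2
    rw [← mul_neg] at h2
    simpa using cancel hij.ne' h1 h2
  have hzero : Y = 0 := by
    ext (i | i) (j | j)
    · rcases eq_or_ne i j with rfl | hij
      · exact hker i 0
      · exact (hlr i j hij).1
    · rcases lt_trichotomy i j with hij | rfl | hij
      · exact (hll i j hij).1
      · exact hker i 1
      · exact (hll j i hij).2
    · rcases lt_trichotomy i j with hij | rfl | hij
      · exact (hrr j i hij).2
      · exact hker i 2
      · exact (hrr i j hij).1
    · rcases eq_or_ne i j with rfl | hij
      -- The Jordan coordinate is the sum of the two diagonal entries, and a kernel coordinate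
      -- already kills the first.
      · have h0 : Y (.inl i) (.inl i) = 0 := hker i 0
        have h1 := hdiagB i
        simp only [rowPos, blockAction_inl_inr, mul_one, one_mul, h0, zero_add] at h1
        exact h1
      · exact (hlr j i hij.symm).2
  calc X = T * S * X * (T * S) := by rw [hTS, Matrix.one_mul, Matrix.mul_one]
    _ = T * Y * S := by rw [hY]; simp only [Matrix.mul_assoc]
    _ = 0 := by rw [hzero, Matrix.mul_zero, Matrix.zero_mul]

/-- Normal form of the pencil of a pair of skew-symmetric matrices in simultaneous normal form. -/
theorem hasAlgType_of_congruence [CharZero K] {Q B : skewForms K (2 * n)}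
    {S : Matrix (Fin n ⊕ Fin n) (Fin (2 * n)) K} {w : Fin n → K} (hw : Function.Injective w)
    (hQ : S * Q.1 * Sᵀ = fromBlocks 0 (diagonal w) (-diagonal w) 0)
    (hB : S * B.1 * Sᵀ = fromBlocks 0 1 (-1) 0) :
    HasAlgType (orbitMap (congruenceRep K (2 * n)) Q) (orbitMap (congruenceRep K (2 * n)) B)
      ⟨Multiset.replicate (3 * n) 1 + Multiset.replicate (2 * n * (n - 1)) 2, 0,
        Multiset.replicate n {1}⟩ := by
  obtain ⟨T, hTS⟩ : ∃ T : Matrix (Fin (2 * n)) (Fin n ⊕ Fin n) K, T * S = 1 := by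
    -- `N` inverts the standard symplectic matrix `S B Sᵀ`, so `S` has a right inverse, two-sided by
    -- equality of sizes.
    let N : Matrix (Fin n ⊕ Fin n) (Fin n ⊕ Fin n) K := fromBlocks 0 (-1) 1 0
    have h : S * (B.1 * Sᵀ * N) = 1 := by
      rw [← Matrix.mul_assoc, ← Matrix.mul_assoc, hB, fromBlocks_multiply]
      simp [fromBlocks_one]
    exact ⟨_, (Matrix.mul_eq_one_comm_of_card_eq _ _ _ (by simp [two_mul])).1 h⟩
  let e := LinearEquiv.ofBijective (colCoord S T Q B w) ⟨colCoord_injective hTS hw hQ hB, by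
    rw [← LinearMap.injective_iff_surjective_of_finrank_eq_finrank]
    · exact colCoord_injective hTS hw hQ hB
    · rw [Module.finrank_fintype_fun_eq_card, card_sigma_normalBlock_cols,
        Module.finrank_matrix]
      simp⟩
  have hdiag (X : Matrix (Fin (2 * n)) (Fin (2 * n)) K) (i : Fin n) :
      congruenceEntry S (rowPos (.inr i)) (orbitMap (congruenceRep K (2 * n)) Q X) =
        w i * congruenceEntry S (rowPos (.inr i)) (orbitMap (congruenceRep K (2 * n)) B X) := by
    simp only [congruenceEntry_orbitMap hTS, hB, hQ, ← diagonal_one, rowPos, blockAction_inl_inr]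
    ring
  have hcA (X) (i) (r : Fin (normalBlock w i).rows) :
      rowCoord S w (orbitMap (congruenceRep K (2 * n)) Q X) ⟨i, r⟩ =
        ∑ c : Fin (normalBlock w i).cols, (normalBlock w i).entryA r c * e X ⟨i, c⟩ := by
    rcases i with p | q | i
    · exact absurd r.2 (Nat.not_lt_zero _)
    · obtain ⟨_ | r, hr⟩ := r
      -- Column `0` of the block stores the `B`-value and column `1` the `Q`-value, so the block `[λ
      -- 1]` acts tautologically.
      · refine Eq.trans ?_ (Fin.sum_univ_two _).symm
        change congruenceEntry S (rowPos (.inl q)) (orbitMap (congruenceRep K (2 * n)) Q X) =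
          (0 : K) * congruenceEntry S (rowPos (.inl q)) (orbitMap (congruenceRep K (2 * n)) B X) +
            (1 : K) * congruenceEntry S (rowPos (.inl q)) (orbitMap (congruenceRep K (2 * n)) Q X)
        rw [zero_mul, one_mul, zero_add]
      · exact absurd hr (by simp [normalBlock, Block.rows])
    · obtain ⟨_ | r, hr⟩ := r
      · refine Eq.trans ?_ (Fin.sum_univ_one _).symm
        exact hdiag X i
      · exact absurd hr (by simp [normalBlock, Block.rows])
  have hcB (X) (i) (r : Fin (normalBlock w i).rows) :
      rowCoord S w (orbitMap (congruenceRep K (2 * n)) B X) ⟨i, r⟩ =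
        ∑ c : Fin (normalBlock w i).cols, (normalBlock w i).entryB r c * e X ⟨i, c⟩ := by
    rcases i with p | q | i
    · exact absurd r.2 (Nat.not_lt_zero _)
    · obtain ⟨_ | r, hr⟩ := r
      · refine Eq.trans ?_ (Fin.sum_univ_two _).symm
        change congruenceEntry S (rowPos (.inl q)) (orbitMap (congruenceRep K (2 * n)) B X) =
          (1 : K) * congruenceEntry S (rowPos (.inl q)) (orbitMap (congruenceRep K (2 * n)) B X) +
            (0 : K) * congruenceEntry S (rowPos (.inl q)) (orbitMap (congruenceRep K (2 * n)) Q X)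
        rw [zero_mul, one_mul, add_zero]
      · exact absurd hr (by simp [normalBlock, Block.rows])
    · obtain ⟨_ | r, hr⟩ := r
      · refine Eq.trans ?_ (Fin.sum_univ_one _).symm
        exact (one_mul _).symm
      · exact absurd hr (by simp [normalBlock, Block.rows])
  -- The row coordinates of `R_B X` are among the column coordinates of `X`, which take arbitrary
  -- values.
  have hsurj : Function.Surjective (rowCoord S w) := by
    intro t
    obtain ⟨X, hX⟩ := e.surjective fun
      | ⟨.inl _, _⟩ => 0
      | ⟨.inr (.inl q), _⟩ => t ⟨.inr (.inl q), (0 : Fin 1)⟩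
      | ⟨.inr (.inr i), _⟩ => t ⟨.inr (.inr i), (0 : Fin 1)⟩
    refine ⟨orbitMap (congruenceRep K (2 * n)) B X, ?_⟩
    funext ⟨i, r⟩
    rcases i with p | q | i
    · exact absurd r.2 (Nat.not_lt_zero _)
    · obtain ⟨_ | r, hr⟩ := r
      · exact congrFun hX ⟨.inr (.inl q), (0 : Fin 2)⟩
      · exact absurd hr (by simp [normalBlock, Block.rows])
    · obtain ⟨_ | r, hr⟩ := r
      · exact congrFun hX ⟨.inr (.inr i), (0 : Fin 1)⟩
      · exact absurd hr (by simp [normalBlock, Block.rows])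
  exact ⟨BlockIndex n, inferInstance, inferInstance, normalBlock w,
    hasNormalForm_of_coordinates e
      (LinearEquiv.ofBijective (rowCoord S w) ⟨rowCoord_injective hTS w, hsurj⟩) hcA hcB,
    algTypeOfBlocks_normalBlock hw⟩

end Coordinates

end JK
-- Non-vanishing of the genericity polynomial
namespace JK

section Genericity

open Matrix

variable {K : Type*} [Field K] {m : ℕ}

/-- The entry `(i, j)` of the first member of a pair of skew-symmetric matrices. -/
def fstEntry (i j : Fin m) : Module.Dual K (skewForms K m × skewForms K m) where
  toFun W := W.1.1 i j
  map_add' W W' := by simp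
  map_smul' c W := by simp

/-- The entry `(i, j)` of the second member of a pair of skew-symmetric matrices. -/
def sndEntry (i j : Fin m) : Module.Dual K (skewForms K m × skewForms K m) where
  toFun W := W.2.1 i j
  map_add' W W' := by simp
  map_smul' c W := by simp

/-- The polynomial `det B · det (tr (adj B · Q) ^ (a + b))` in the entries of `Q` and `B`. -/
noncomputable def genericityPolynomial (K : Type*) [Field K] (m n : ℕ) :
    MvPolynomial (Module.Dual K (skewForms K m × skewForms K m)) K :=
  (Matrix.of fun i j => MvPolynomial.X (sndEntry i j)).det *
    (Matrix.of fun a b : Fin n =>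
      (((Matrix.of fun i j : Fin m => MvPolynomial.X (sndEntry i j)).adjugate *
        Matrix.of fun i j => MvPolynomial.X (fstEntry i j)) ^ (a + b : ℕ)).trace).det

theorem eval_genericityPolynomial (n : ℕ) (W : skewForms K m × skewForms K m) :
    MvPolynomial.eval (fun φ : Module.Dual K (skewForms K m × skewForms K m) => φ W)
      (genericityPolynomial K m n) =
    W.2.1.det * (Matrix.of fun a b : Fin n =>
      ((W.2.1.adjugate * W.1.1) ^ (a + b : ℕ)).trace).det := by
  set ev := MvPolynomial.eval (fun φ : Module.Dual K (skewForms K m × skewForms K m) => φ W)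
  have hfst : ev.mapMatrix (Matrix.of fun i j => MvPolynomial.X (fstEntry i j)) = W.1.1 := by
    ext i j
    exact MvPolynomial.eval_X _
  have hsnd : ev.mapMatrix (Matrix.of fun i j => MvPolynomial.X (sndEntry i j)) = W.2.1 := by
    ext i j
    exact MvPolynomial.eval_X _
  have htr (M : Matrix (Fin m) (Fin m) _) : ev M.trace = (ev.mapMatrix M).trace := by
    simp [Matrix.trace]
  rw [genericityPolynomial, map_mul, RingHom.map_det, RingHom.map_det, hsnd]
  congr 2
  ext a b
  simp only [RingHom.mapMatrix_apply, Matrix.map_apply, Matrix.of_apply]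
  rw [htr, map_pow, map_mul, RingHom.map_adjugate, hsnd, hfst]

/-- A pair of skew-symmetric matrices where the genericity polynomial does not vanish. -/
theorem exists_eval_genericityPolynomial_ne_zero (K : Type*) [Field K] [CharZero K] (n : ℕ) :
    ∃ W : skewForms K (2 * n) × skewForms K (2 * n),
      MvPolynomial.eval (fun φ : Module.Dual K (skewForms K (2 * n) × skewForms K (2 * n)) => φ W)
        (genericityPolynomial K (2 * n) n) ≠ 0 := by
  let σ : Fin n ⊕ Fin n ≃ Fin (2 * n) := finSumFinEquiv.trans (finCongr (two_mul n).symm)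
  -- Characteristic zero makes these eigenvalues distinct.
  let w : Fin n → K := fun i => (i : ℕ)
  let D : Matrix (Fin n ⊕ Fin n) (Fin n ⊕ Fin n) K := fromBlocks 0 (diagonal w) (-diagonal w) 0
  let E : Matrix (Fin n ⊕ Fin n) (Fin n ⊕ Fin n) K := fromBlocks 0 1 (-1) 0
  have hD : Dᵀ = -D := by simp [D, fromBlocks_transpose, fromBlocks_neg]
  have hE : Eᵀ = -E := by simp [E, fromBlocks_transpose, fromBlocks_neg]
  have hEE : -E * E = 1 := by
    simp [E, fromBlocks_neg, fromBlocks_multiply, fromBlocks_one]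
  have hdet : E.det ≠ 0 := by
    intro h
    have := congrArg Matrix.det hEE
    rw [det_mul, h, mul_zero, det_one] at this
    exact zero_ne_one this
  have hadj : E.adjugate = E.det • -E := by
    calc E.adjugate = (-E * E) * E.adjugate := by rw [hEE, Matrix.one_mul]
      _ = E.det • -E := by rw [Matrix.mul_assoc, mul_adjugate]; simp
  have hprod : E.adjugate * D = Matrix.diagonal (Sum.elim (E.det • w) (E.det • w)) := by
    have hED : -E * D = fromBlocks (diagonal w) 0 0 (diagonal w) := by
      simp [E, D, fromBlocks_neg, fromBlocks_multiply]
    rw [hadj, ← fromBlocks_diagonal, Matrix.smul_mul, hED, fromBlocks_smul, diagonal_smul,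
      smul_zero]
  refine ⟨⟨⟨D.submatrix σ.symm σ.symm, ?_⟩, ⟨E.submatrix σ.symm σ.symm, ?_⟩⟩, ?_⟩
  · exact congrArg (fun A : Matrix _ _ K => A.submatrix σ.symm σ.symm) hD
  · exact congrArg (fun A : Matrix _ _ K => A.submatrix σ.symm σ.symm) hE
  rw [eval_genericityPolynomial]
  have hpow (k : ℕ) : (((E.submatrix σ.symm σ.symm).adjugate * D.submatrix σ.symm σ.symm) ^ k).trace
      = 2 * ∑ i, (E.det * w i) ^ k := by
    have h1 : (E.submatrix σ.symm σ.symm).adjugate * D.submatrix σ.symm σ.symm =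
        Matrix.diagonal (Sum.elim (E.det • w) (E.det • w) ∘ σ.symm) := by
      rw [adjugate_submatrix_equiv_self, submatrix_mul_equiv, hprod, submatrix_diagonal_equiv]
    rw [h1, diagonal_pow, trace_diagonal]
    rw [← σ.sum_comp, Fintype.sum_sum_type]
    simp [two_mul]
  refine mul_ne_zero (by rwa [det_submatrix_equiv_self]) ?_
  -- Every eigenvalue occurs twice, so the Hankel matrix is `2 VᵀV` with `V` the Vandermonde matrix
  -- of the distinct ones.
  have hH : (Matrix.of fun a b : Fin n =>
      (((E.submatrix σ.symm σ.symm).adjugate * D.submatrix σ.symm σ.symm) ^ (a + b : ℕ)).trace) =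
      (2 : K) • ((vandermonde fun i => E.det * w i)ᵀ * vandermonde fun i => E.det * w i) := by
    ext a b
    rw [Matrix.of_apply, hpow]
    simp only [Matrix.smul_apply, Matrix.mul_apply, transpose_apply, vandermonde_apply, pow_add,
      smul_eq_mul]
  have hvand : (vandermonde fun i => E.det * w i).det ≠ 0 :=
    det_vandermonde_ne_zero_iff.2 fun i j hij =>
      Fin.ext (Nat.cast_injective (mul_left_cancel₀ hdet hij))
  rw [hH, det_smul, det_mul, det_transpose]
  exact mul_ne_zero (pow_ne_zero _ two_ne_zero) (mul_ne_zero hvand hvand)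

end Genericity

end JK

/-! ### The main theorem -/

theorem theoremT (K : Type*) [Field K] [IsAlgClosed K] [CharZero K] (n : ℕ) :
    ∃ T : JK.AlgType, JK.IsJKInvariant (JK.congruenceRep K (2 * n)) T ∧
      Multiset.card T.horizontal = n * (2 * n + 1) ∧
      T.horizontal = Multiset.replicate (3 * n) 1 + Multiset.replicate (2 * n * (n - 1)) 2 ∧
      T.vertical = 0 ∧
      T.jordan = Multiset.replicate n {1} := by
  refine ⟨⟨Multiset.replicate (3 * n) 1 + Multiset.replicate (2 * n * (n - 1)) 2, 0,
    Multiset.replicate n {1}⟩, ⟨JK.genericityPolynomial K (2 * n) n,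
      JK.exists_eval_genericityPolynomial_ne_zero K n, fun W hW => ?_⟩, ?_, rfl, rfl, rfl⟩
  · rw [JK.eval_genericityPolynomial] at hW
    obtain ⟨S, w, hw, hQ, hB⟩ := JK.exists_congruence_normal_form (n := n) W.1.1 W.2.1 W.1.2 W.2.2
      (left_ne_zero_of_mul hW) (right_ne_zero_of_mul hW)
    exact JK.hasAlgType_of_congruence hw hQ hB
  · rw [Multiset.card_add, Multiset.card_replicate, Multiset.card_replicate]
    -- Splitting off `n = 0` removes the truncated subtraction `n - 1`.
    cases n with
    | zero => rfl
    | succ n => simp only [Nat.add_sub_cancel]; ring
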